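/- \textbf{Theorem (The Gaussian Bound).} Let $m\le n$ be natural numbers, $\varepsilon>0$, and let $\mathcal M$ be a randomized mechanism which assigns to each database $D\in\mathbb R^n$ a random output in a measurable space $\mathcal Y$ and which is $\varepsilon\ell_1$-private, i.e. $\Pr[\mathcal M(D)\in S]\le e^{\varepsilon\|D-D'\|_1}\Pr[\mathcal M(D')\in S]$ for all $D,D'\in\mathbb R^n$ and all measurable $S\subseteq\mathcal Y$. Let $I=[a,b]\subset\mathbb R$ with $a\le b$, let $M=b-a$ be its diameter, and let $\mathcal M_I=\mathcal M\circ c_I$ be the clipped mechanism, where $c_I(D)_i=\max(a,\min(b,D_i))$. Let the input $\mathbf X=(X_1,\dots,X_n)$ be multivariate Gaussian $\mathcal N(\mu,\Sigma_\rho)$, i.e. have the density $p_{\mathbf X}(\mathbf x)=((2\pi)^n\det\Sigma_\rho)^{-1/2}\exp(-\tfrac12(\mathbf x-\mu)^\top\Sigma_\rho^{-1}(\mathbf x-\mu))$, where $\mu\in\mathbb R^n$, $\rho\in[0,1]$, and $\Sigma_\rho\in\mathbb R^{n\times n}$ is symmetric and positive definite with constant diagonal $\sigma^2>0$ and $|(\Sigma_\rho)_{ij}|\le\rho\sigma^2$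 for all $i\ne j$. Assume that $\mathbf X$ has at most $m$ correlated random variables, i.e. $\{1,\dots,n\}$ is a disjoint union of sets $C_1,\dots,C_r$ of cardinality at most $m$ such that, for each $l$, $(X_j)_{j\in C_l}$ is independent of $(X_j)_{j\notin C_l}$. Assume that $\rho(m-2)<1$. Then the clipped mechanism $\mathcal M_I$ is $$\left(\frac{m^2}{4\left(\frac1\rho-m+2\right)}+1\right)M\varepsilon\text{-BDP}$$ (for $\rho=0$ we put $\frac1\rho=\infty$, so that the factor is $1$), where Bayesian differential privacy on the data domain $\mathbb R^n$ is understood for target values at distance at most $M$: a mechanism with output $Y$ is $\delta$-BDP if $$\sup_{i,\,K}\ \sup_{\mathbf x_K,\,|x_i-x_i'|\le M,\,S}\ \ln\frac{\Pr[Y\in S\mid \mathbf X_K=\mathbf x_K,\,X_i=x_i]}{\Pr[Y\in S\mid \mathbf X_K=\mathbf x_K,\,X_i=x_i']}\ \le\ \delta,$$ the suprema being over all $i\in\{1,\dots,n\}$, $K\subseteq\{1,\dots,n\}\setminus\{i\}$, $\mathbf x_K\in\mathbb R^{K}$, $x_i,x_i'\in\mathbb R$ with $|x_i-x_i'|\le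 M$, and measurable $S\subseteq\mathcal Y$ (a quotient $0/0$ does not contribute). Here, with $U=\{1,\dots,n\}\setminus(K\cup\{i\})$, $\Pr[Y\in S\mid\mathbf X_K=\mathbf x_K,X_i=x_i]=\int_{\mathbb R^U}\Pr[Y\in S\mid \mathbf X=(\mathbf x_K,x_i,\mathbf x_U)]\;p_{\mathbf X_U}(\mathbf x_U\mid\mathbf x_K,x_i)\,\mathrm d\mathbf x_U$, with the conditional density $p_{\mathbf X_U}(\mathbf x_U\mid\mathbf x_K,x_i)=p_{\mathbf X}(\mathbf x_K,x_i,\mathbf x_U)\big/\int_{\mathbb R^U}p_{\mathbf X}(\mathbf x_K,x_i,\mathbf z)\,\mathrm d\mathbf z$. -/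

import Mathlib

open MeasureTheory ProbabilityTheory
open scoped ENNReal

noncomputable section

namespace BayesDP

/-- A randomized mechanism on databases of `n` real records with outputs in `Y`: for each database
`D`, the measure `𝓜 D` is the law of the output (it is used with `IsMarkovKernel 𝓜`). -/
abbrev Mechanism (n : ℕ) (Y : Type*) [MeasurableSpace Y] := Kernel (Fin n → ℝ) Y

/-- Metric privacy: `Pr[𝓜(D) ∈ S] ≤ exp (d(D, D')) * Pr[𝓜(D') ∈ S]` for all databases `D`, `D'` and
all measurable `S`. -/
def IsMetricPrivate {n : ℕ} {Y : Type*} [MeasurableSpace Y]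
    (d : (Fin n → ℝ) → (Fin n → ℝ) → ℝ) (𝓜 : Mechanism n Y) : Prop :=
  ∀ D D' : Fin n → ℝ, ∀ S : Set Y, MeasurableSet S →
    𝓜 D S ≤ ENNReal.ofReal (Real.exp (d D D')) * 𝓜 D' S

/-- The `ℓ₁` distance of two databases. -/
def l1Dist {n : ℕ} (D D' : Fin n → ℝ) : ℝ := ∑ i, |D i - D' i|

/-- Clipping every record to the interval `[a, b]`. -/
def clip {n : ℕ} (a b : ℝ) (D : Fin n → ℝ) : Fin n → ℝ := fun i => max a (min b (D i))

theorem measurable_clip {n : ℕ} (a b : ℝ) : Measurable (clip (n := n) a b) := by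
  unfold clip
  fun_prop

/-- The clipped version `𝓜 ∘ clip` of a mechanism. -/
def Mechanism.clipped {n : ℕ} {Y : Type*} [MeasurableSpace Y] (𝓜 : Mechanism n Y) (a b : ℝ) :
    Mechanism n Y :=
  Kernel.comap 𝓜 (clip a b) (measurable_clip a b)

/-- The density of the multivariate Gaussian distribution with mean `μ` and (symmetric positive
definite) covariance matrix `V`. -/
def gaussianDensity {n : ℕ} (μ : Fin n → ℝ) (V : Matrix (Fin n) (Fin n) ℝ) (x : Fin n → ℝ) :
    ℝ≥0∞ :=
  ENNReal.ofReal ((Real.sqrt ((2 * Real.pi) ^ n * V.det))⁻¹ *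
    Real.exp (-(1 / 2) * ((x - μ) ⬝ᵥ (V⁻¹.mulVec (x - μ)))))

/-- The random vector `X` has probability density `p` with respect to Lebesgue measure. -/
def HasDensity {n : ℕ} {Ω : Type*} [MeasurableSpace Ω] (P : Measure Ω) (X : Ω → Fin n → ℝ)
    (p : (Fin n → ℝ) → ℝ≥0∞) : Prop :=
  Measurable X ∧ P.map X = (volume : Measure (Fin n → ℝ)).withDensity p

/-- Limited covariance matrix: symmetric positive definite, constant diagonal `σ² > 0`, and all
off-diagonal entries at most `ρ * σ²` in absolute value. -/
def IsLimitedCovariance {n : ℕ} (ρ : ℝ) (V : Matrix (Fin n) (Fin n) ℝ) : Prop :=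
  V.PosDef ∧ ∃ σ2 : ℝ, 0 < σ2 ∧ (∀ i, V i i = σ2) ∧ ∀ i j, i ≠ j → |V i j| ≤ ρ * σ2

/-- `X` has at most `m` correlated random variables: the indices can be partitioned into blocks of
at most `m` elements such that, for each block `C`, the vector of the variables in `C` is
independent of the vector of the variables outside `C`. -/
def AtMostCorrelated {n : ℕ} {Ω : Type*} [MeasurableSpace Ω] (P : Measure Ω) (X : Ω → Fin n → ℝ)
    (m : ℕ) : Prop :=
  ∃ C : Finpartition (Finset.univ : Finset (Fin n)), ∀ c ∈ C.parts,
    c.card ≤ m ∧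
      IndepFun (fun ω (j : {j // j ∈ c}) => X ω j) (fun ω (j : {j // j ∉ c}) => X ω j) P

/-- The database whose records in `K` are `xK`, whose record `i` is `t`, and whose remaining records
are `y`. -/
def assemble {n : ℕ} (K : Finset (Fin n)) (i : Fin n) (xK : {j // j ∈ K} → ℝ) (t : ℝ)
    (y : {j // j ∉ insert i K} → ℝ) : Fin n → ℝ := fun j =>
  if hK : j ∈ K then xK ⟨j, hK⟩
  else if hi : j = i then t
  else y ⟨j, by simp [hK, hi]⟩

/-- `Pr[Y ∈ S | X_K = xK, X_i = t]` when the input has density `p`: the integral of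
`Pr[𝓜(x) ∈ S]` against the conditional density `p(x_U | xK, t) = p(xK, t, x_U) / ∫ p(xK, t, ·)`
of the remaining records `x_U`. -/
def condProb {n : ℕ} {Y : Type*} [MeasurableSpace Y] (𝓜 : Mechanism n Y)
    (p : (Fin n → ℝ) → ℝ≥0∞) (K : Finset (Fin n)) (i : Fin n) (xK : {j // j ∈ K} → ℝ) (t : ℝ)
    (S : Set Y) : ℝ≥0∞ :=
  ∫⁻ y : {j // j ∉ insert i K} → ℝ, 𝓜 (assemble K i xK t y) S *
    (p (assemble K i xK t y) / ∫⁻ z : {j // j ∉ insert i K} → ℝ, p (assemble K i xK t z))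

/-- The leakage towards the adversary who targets record `i` and knows the records in `K`: the
supremum of `ln (Pr[Y ∈ S | xK, t] / Pr[Y ∈ S | xK, t'])` over known values `xK`, measurable `S`,
and target values `t`, `t'` at distance at most `M`. (`ENNReal.log 0 = ⊥`, so that `0 / 0` does
not contribute, and a positive number over `0` contributes `⊤`.) -/
def adversaryLeakage {n : ℕ} {Y : Type*} [MeasurableSpace Y] (𝓜 : Mechanism n Y)
    (p : (Fin n → ℝ) → ℝ≥0∞) (M : ℝ) (K : Finset (Fin n)) (i : Fin n) : EReal :=
  ⨆ (xK : {j // j ∈ K} → ℝ) (t : ℝ) (t' : ℝ) (_ : |t - t'| ≤ M) (S : Set Y)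
    (_ : MeasurableSet S),
    ENNReal.log (condProb 𝓜 p K i xK t S / condProb 𝓜 p K i xK t' S)

/-- The Bayesian differential privacy leakage `BDPL(𝓜; M)` for real-valued records: the supremum of
the leakage over all adversaries `(K, i)` with `i ∉ K`. -/
def leakage {n : ℕ} {Y : Type*} [MeasurableSpace Y] (𝓜 : Mechanism n Y)
    (p : (Fin n → ℝ) → ℝ≥0∞) (M : ℝ) : EReal :=
  ⨆ (i : Fin n) (K : Finset (Fin n)) (_ : i ∉ K), adversaryLeakage 𝓜 p M K i

/-- `δ`-Bayesian differential privacy, for target values at distance at most `M` and input data with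
density `p`. -/
def IsBDP {n : ℕ} {Y : Type*} [MeasurableSpace Y] (𝓜 : Mechanism n Y)
    (p : (Fin n → ℝ) → ℝ≥0∞) (M δ : ℝ) : Prop :=
  leakage 𝓜 p M ≤ (δ : EReal)

/-- The factor `m² / (4 (1/ρ - m + 2)) + 1`, where for `ρ = 0` one has `1/ρ = ∞`, so that the
fraction vanishes. -/
def gaussianFactor (m : ℕ) (ρ : ℝ) : ℝ :=
  if ρ = 0 then 1 else (m : ℝ) ^ 2 / (4 * (1 / ρ - m + 2)) + 1

end BayesDP

end

/-!
The conditional law of the unknown records `X_U` given `X_K = xK` and `X_i = t` is Gaussian, its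
covariance does not depend on `t`, and its mean is an affine function of `t`. Hence two target
values `t`, `t'` can be coupled by translating the unknown records by `(t' - t) d_U`, and metric
privacy and the `1`-Lipschitz clipping bound the leakage by `ε |t - t'| ∑ j, |d j|`, where
`d i = 1` and `d` vanishes on `K`.

Neither Schur complements nor marginal densities are needed to carry this out. By
`gaussianDensity_add_mulVec`, translating the Gaussian density by `V v` multiplies it by a function
of `v ⬝ᵥ x` only; so if `v` is supported on `K ∪ {i}`, that factor is a function of the known
records and cancels in the conditional density (`condProb_clipped_le`). It remains to choose `v`
with `(V v) i = 1` and `V v = 0` on `K`, i.e. `v` solves a linear system with a principal submatrix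
of `V`, and to bound the `ℓ₁` norm of `d = V v`.

Comparing the Laplace transforms `E exp (s ⬝ᵥ (X - μ)) = exp (s ⬝ᵥ V s / 2)` shows that `V` has only
zero entries between a block `c` and its complement (`covariance_apply_eq_zero_of_indepFun`). So only
the block `c` of `i` matters. If it contains `k` known and `u` unknown records besides `i`, then
`k + u + 1 ≤ m`, diagonal dominance gives `σ² ‖v‖₁ ≤ 1 / (1 - k ρ)`, and every unknown record has
`|d j| ≤ ρ σ² ‖v‖₁`. The resulting bound `u ρ / (1 - k ρ)` is at most `m² / (4 (1 / ρ - m + 2))`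
(`mul_div_one_sub_mul_le_gaussianFactor`).
-/

open Matrix

namespace BayesDP

/-! ### Translations and the Laplace transform of the Gaussian density -/

theorem gaussianDensity_add_mulVec {n : ℕ} (μ : Fin n → ℝ) {V : Matrix (Fin n) (Fin n) ℝ}
    (hV : V.PosDef) (x v : Fin n → ℝ) :
    gaussianDensity μ V (x + V *ᵥ v) =
      ENNReal.ofReal (Real.exp (-(v ⬝ᵥ (x - μ)) - 1 / 2 * (v ⬝ᵥ V *ᵥ v))) *
        gaussianDensity μ V x := by
  have hdet : IsUnit V.det := (Matrix.isUnit_iff_isUnit_det V).1 hV.isUnit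
  have h1 : V⁻¹ *ᵥ (V *ᵥ v) = v := by
    rw [mulVec_mulVec, nonsing_inv_mul _ hdet, one_mulVec]
  have hsymm : V⁻¹ᵀ = V⁻¹ := by
    rw [transpose_nonsing_inv]
    rw [← conjTranspose_eq_transpose_of_trivial, hV.isHermitian.eq]
  have h2 : (V *ᵥ v) ⬝ᵥ (V⁻¹ *ᵥ (x - μ)) = v ⬝ᵥ (x - μ) := by
    rw [dotProduct_mulVec, ← mulVec_transpose, hsymm, h1]
  have hx : x + V *ᵥ v - μ = (x - μ) + V *ᵥ v := by abel
  unfold gaussianDensity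
  rw [← ENNReal.ofReal_mul (Real.exp_nonneg _), mul_left_comm, ← Real.exp_add, hx, mulVec_add, h1]
  congr 3
  simp only [add_dotProduct, dotProduct_add, h2]
  rw [dotProduct_comm (x - μ) v, dotProduct_comm (V *ᵥ v) v]
  ring

theorem measurable_gaussianDensity {n : ℕ} (μ : Fin n → ℝ) (V : Matrix (Fin n) (Fin n) ℝ) :
    Measurable (gaussianDensity μ V) := by
  unfold gaussianDensity
  refine ENNReal.measurable_ofReal.comp (Continuous.measurable ?_)
  fun_prop

/-- The Laplace transform of a Gaussian vector. Up to the factor on the right-hand side, the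
integrand times the density is the density translated by `V *ᵥ s`, whose total mass is `1`. -/
theorem lintegral_exp_dotProduct_sub {n : ℕ} {Ω : Type*} [MeasurableSpace Ω] {P : Measure Ω}
    [IsProbabilityMeasure P] {X : Ω → Fin n → ℝ} {μ : Fin n → ℝ} {V : Matrix (Fin n) (Fin n) ℝ}
    (hV : V.PosDef) (hX : HasDensity P X (gaussianDensity μ V)) (s : Fin n → ℝ) :
    ∫⁻ ω, ENNReal.ofReal (Real.exp (s ⬝ᵥ (X ω - μ))) ∂P =
      ENNReal.ofReal (Real.exp (1 / 2 * (s ⬝ᵥ V *ᵥ s))) := by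
  have hmeas : Measurable fun x : Fin n → ℝ => ENNReal.ofReal (Real.exp (s ⬝ᵥ (x - μ))) :=
    ENNReal.measurable_ofReal.comp (Continuous.measurable (by fun_prop))
  have hmass : ∫⁻ x, gaussianDensity μ V x = 1 := by
    have h := congrArg (fun ν => ν Set.univ) hX.2
    simpa [Measure.map_apply hX.1] using h.symm
  rw [← lintegral_map (f := fun x => ENNReal.ofReal (Real.exp (s ⬝ᵥ (x - μ)))) hmeas hX.1, hX.2,
    lintegral_withDensity_eq_lintegral_mul _ (measurable_gaussianDensity μ V) hmeas]
  have hpt : ∀ x, (gaussianDensity μ V *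
      fun x => ENNReal.ofReal (Real.exp (s ⬝ᵥ (x - μ)))) x =
      ENNReal.ofReal (Real.exp (1 / 2 * (s ⬝ᵥ V *ᵥ s))) *
        gaussianDensity μ V (x + V *ᵥ (-s)) := by
    intro x
    rw [gaussianDensity_add_mulVec μ hV, ← mul_assoc,
      ← ENNReal.ofReal_mul (Real.exp_nonneg _), ← Real.exp_add, Pi.mul_apply, mul_comm]
    congr 3
    simp only [mulVec_neg, neg_dotProduct, dotProduct_neg]
    ring
  rw [lintegral_congr hpt, lintegral_const_mul' _ _ ENNReal.ofReal_ne_top,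
    lintegral_add_right_eq_self (gaussianDensity μ V), hmass, mul_one]

theorem covariance_apply_eq_zero_of_indepFun {n : ℕ} {Ω : Type*} [MeasurableSpace Ω]
    {P : Measure Ω} [IsProbabilityMeasure P] {X : Ω → Fin n → ℝ} {μ : Fin n → ℝ}
    {V : Matrix (Fin n) (Fin n) ℝ} (hV : V.PosDef) (hX : HasDensity P X (gaussianDensity μ V))
    {j l : Fin n} (hind : IndepFun (fun ω => X ω j) (fun ω => X ω l) P) :
    V j l = 0 := by
  have hmeas (r : Fin n) : Measurable fun t : ℝ => ENNReal.ofReal (Real.exp (t - μ r)) := by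
    fun_prop
  have hXm (r : Fin n) : Measurable fun ω => X ω r := (measurable_pi_apply r).comp hX.1
  have h := lintegral_mul_eq_lintegral_mul_lintegral_of_indepFun
    ((hmeas j).comp (hXm j)) ((hmeas l).comp (hXm l)) (hind.comp (hmeas j) (hmeas l))
  have hone (r : Fin n) : ∫⁻ ω, ENNReal.ofReal (Real.exp (X ω r - μ r)) ∂P =
      ENNReal.ofReal (Real.exp (1 / 2 * V r r)) := by
    simpa using lintegral_exp_dotProduct_sub hV hX (Pi.single r 1)
  have htwo : ∫⁻ ω, ENNReal.ofReal (Real.exp (X ω j - μ j)) *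
        ENNReal.ofReal (Real.exp (X ω l - μ l)) ∂P =
      ENNReal.ofReal (Real.exp (1 / 2 * (V j j + V j l + (V l j + V l l)))) := by
    have := lintegral_exp_dotProduct_sub hV hX (Pi.single j 1 + Pi.single l 1)
    simp only [add_dotProduct, mulVec_add, dotProduct_add, single_one_dotProduct, Real.exp_add,
      mulVec_single_one, col_apply, Pi.sub_apply, ENNReal.ofReal_mul (Real.exp_nonneg _)] at this
    rw [this]
    congr 3
    ring
  have hsymm : V l j = V j l := by simpa using hV.isHermitian.apply j l
  simp only [Pi.mul_apply, Function.comp_apply] at h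
  rw [htwo, hone, hone, ← ENNReal.ofReal_mul (Real.exp_nonneg _), ← Real.exp_add,
    ENNReal.ofReal_eq_ofReal_iff (Real.exp_nonneg _) (Real.exp_nonneg _), Real.exp_eq_exp] at h
  linarith

/-! ### The direction in which the conditional mean moves -/

theorem exists_mulVec_eq_single_on {n : ℕ} {V : Matrix (Fin n) (Fin n) ℝ} (hV : V.PosDef)
    (T : Finset (Fin n)) (i : Fin n) :
    ∃ v : Fin n → ℝ, (∀ j ∉ T, v j = 0) ∧
      ∀ r ∈ T, (V *ᵥ v) r = (Pi.single i 1 : Fin n → ℝ) r := by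
  set W : Matrix T T ℝ := V.submatrix Subtype.val Subtype.val with hW
  have hsub : W.PosDef := hV.submatrix Subtype.val_injective
  have hdet : IsUnit W.det := (Matrix.isUnit_iff_isUnit_det W).1 hsub.isUnit
  set w : T → ℝ := W⁻¹ *ᵥ fun r => (Pi.single i 1 : Fin n → ℝ) r with hw
  have hWw : W *ᵥ w = fun r : T => (Pi.single i 1 : Fin n → ℝ) r := by
    rw [hw, mulVec_mulVec, mul_nonsing_inv _ hdet, one_mulVec]
  refine ⟨fun j => if h : j ∈ T then w ⟨j, h⟩ else 0, fun j hj => by simp [hj], fun r hr => ?_⟩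
  rw [← congrFun hWw ⟨r, hr⟩]
  simp only [mulVec, dotProduct, hW, submatrix_apply]
  rw [← Finset.sum_subset (Finset.subset_univ T) (fun j _ hj => by simp [hj]),
    ← Finset.sum_coe_sort T]
  exact Finset.sum_congr rfl fun s _ => by simp

/-- Diagonal dominance: summing `σ2 |v r| ≤ δ_{ri} + ρ σ2 ∑ s ≠ r, |v s|` over `r ∈ T`. -/
theorem sum_abs_mul_le_one {n : ℕ} {V : Matrix (Fin n) (Fin n) ℝ} {ρ σ2 : ℝ}
    (hdiag : ∀ i, V i i = σ2) (hoff : ∀ i j, i ≠ j → |V i j| ≤ ρ * σ2)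
    {T : Finset (Fin n)} {i : Fin n} (hi : i ∈ T) {v : Fin n → ℝ} (hv : ∀ j ∉ T, v j = 0)
    (hVv : ∀ r ∈ T, (V *ᵥ v) r = (Pi.single i 1 : Fin n → ℝ) r) :
    (1 - (T.card - 1) * ρ) * (σ2 * ∑ r ∈ T, |v r|) ≤ 1 := by
  have hrow : ∀ r ∈ T, σ2 * |v r| ≤
      (Pi.single i 1 : Fin n → ℝ) r + ρ * σ2 * ((∑ s ∈ T, |v s|) - |v r|) := by
    intro r hr
    have h1 : (V *ᵥ v) r = V r r * v r + ∑ s ∈ T.erase r, V r s * v s := by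
      rw [Finset.add_sum_erase T (fun s => V r s * v s) hr]
      exact (Finset.sum_subset (Finset.subset_univ T) fun j _ hj => by simp [hv j hj]).symm
    have h2 : |∑ s ∈ T.erase r, V r s * v s| ≤ ρ * σ2 * ((∑ s ∈ T, |v s|) - |v r|) := by
      rw [← Finset.sum_erase_eq_sub hr, Finset.mul_sum]
      refine (Finset.abs_sum_le_sum_abs _ _).trans (Finset.sum_le_sum fun s hs => ?_)
      rw [abs_mul]
      exact mul_le_mul_of_nonneg_right (hoff r s (Finset.ne_of_mem_erase hs).symm) (abs_nonneg _)
    have h3 : (0 : ℝ) ≤ (Pi.single i 1 : Fin n → ℝ) r := by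
      rw [Pi.single_apply]; split_ifs <;> norm_num
    rw [hVv r hr, hdiag] at h1
    rcases abs_cases (v r) with ⟨h, -⟩ | ⟨h, -⟩ <;> rw [h] at h2 ⊢ <;>
      linarith [abs_le.1 h2]
  have hsum := Finset.sum_le_sum hrow
  rw [← Finset.mul_sum, Finset.sum_add_distrib, ← Finset.mul_sum, Finset.sum_sub_distrib,
    Finset.sum_const, nsmul_eq_mul] at hsum
  have hone : ∑ r ∈ T, (Pi.single i 1 : Fin n → ℝ) r = 1 := by
    rw [Finset.sum_eq_single_of_mem i hi fun r _ hr => Pi.single_eq_of_ne hr _, Pi.single_eq_same]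
  linarith

theorem one_le_gaussianFactor {m : ℕ} {ρ : ℝ} (hρ0 : 0 ≤ ρ) (hρm : ρ * ((m : ℝ) - 2) < 1) :
    1 ≤ gaussianFactor m ρ := by
  unfold gaussianFactor
  split_ifs with h
  · exact le_rfl
  · have hρ : 0 < ρ := lt_of_le_of_ne hρ0 (Ne.symm h)
    have hA : (m : ℝ) - 2 < 1 / ρ := by rw [lt_div_iff₀ hρ]; linarith
    have : 0 ≤ (m : ℝ) ^ 2 / (4 * (1 / ρ - m + 2)) :=
      div_nonneg (by positivity) (by linarith)
    linarith

theorem mul_div_one_sub_mul_le_gaussianFactor {m u k : ℕ} {ρ : ℝ} (hρ0 : 0 ≤ ρ)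
    (hρm : ρ * ((m : ℝ) - 2) < 1) (hu : 1 ≤ u) (huk : k + u + 1 ≤ m) :
    u * (ρ / (1 - k * ρ)) + 1 ≤ gaussianFactor m ρ := by
  unfold gaussianFactor
  split_ifs with h
  · simp [h]
  · have hρ : 0 < ρ := lt_of_le_of_ne hρ0 (Ne.symm h)
    have hu' : (1 : ℝ) ≤ u := by exact_mod_cast hu
    have huk' : (k : ℝ) + u + 1 ≤ m := by exact_mod_cast huk
    have hA : 0 < 1 / ρ - m + 2 := by
      have : (m : ℝ) - 2 < 1 / ρ := by rw [lt_div_iff₀ hρ]; linarith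
      linarith
    have hfrac : ρ / (1 - k * ρ) = 1 / (1 / ρ - k) := by
      field_simp
    rw [hfrac]
    set A := 1 / ρ - m + 2 with hAdef
    have hden : A + (u - 1) ≤ 1 / ρ - k := by linarith
    have hpos : 0 < A + (u - 1) := by linarith
    have h1 : (u : ℝ) * (1 / (1 / ρ - k)) ≤ u / (A + (u - 1)) := by
      rw [mul_one_div]
      exact div_le_div_of_nonneg_left (by linarith) hpos hden
    -- `(u + 1)² (A + u - 1) - 4 A u = A (u - 1)² + (u + 1)² (u - 1)`, and `u + 1 ≤ m`.
    have h2 : (u : ℝ) / (A + (u - 1)) ≤ (m : ℝ) ^ 2 / (4 * A) := by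
      rw [div_le_div_iff₀ hpos (by linarith)]
      have hm : ((u : ℝ) + 1) ^ 2 ≤ (m : ℝ) ^ 2 :=
        pow_le_pow_left₀ (by linarith) (by linarith [Nat.cast_nonneg (α := ℝ) k]) 2
      have h3 := mul_le_mul_of_nonneg_right hm hpos.le
      have h4 : 0 ≤ A * ((u : ℝ) - 1) ^ 2 := by positivity
      have h5 : 0 ≤ ((u : ℝ) + 1) ^ 2 * (u - 1) := mul_nonneg (by positivity) (by linarith)
      nlinarith
    linarith

/-- The vector `V *ᵥ v` is the derivative, with respect to the target value, of the conditional mean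
of all records given the records in `K` and record `i`. -/
theorem exists_conditionalMean_direction {n m : ℕ} {V : Matrix (Fin n) (Fin n) ℝ} {ρ : ℝ}
    (hρ0 : 0 ≤ ρ) (hρm : ρ * ((m : ℝ) - 2) < 1) (hV : IsLimitedCovariance ρ V)
    {c : Finset (Fin n)} (hcm : c.card ≤ m) (hblock : ∀ j ∈ c, ∀ l ∉ c, V l j = 0)
    {K : Finset (Fin n)} {i : Fin n} (hic : i ∈ c) (hiK : i ∉ K) :
    ∃ v : Fin n → ℝ, (∀ j ∉ insert i K, v j = 0) ∧ (V *ᵥ v) i = 1 ∧ (∀ j ∈ K, (V *ᵥ v) j = 0) ∧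
      ∑ j, |(V *ᵥ v) j| ≤ gaussianFactor m ρ := by
  obtain ⟨hpos, σ2, hσ, hdiag, hoff⟩ := hV
  set T := insert i (K ∩ c) with hT
  have hiT : i ∈ T := Finset.mem_insert_self _ _
  have hTc : T ⊆ c := Finset.insert_subset hic Finset.inter_subset_right
  obtain ⟨v, hv, hVv⟩ := exists_mulVec_eq_single_on hpos T i
  have hout : ∀ l ∉ c, (V *ᵥ v) l = 0 := by
    intro l hl
    rw [mulVec, dotProduct]
    refine Finset.sum_eq_zero fun j _ => ?_
    by_cases hj : j ∈ T
    · rw [hblock j (hTc hj) l hl, zero_mul]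
    · rw [hv j hj, mul_zero]
  have hVi : (V *ᵥ v) i = 1 := by rw [hVv i hiT, Pi.single_eq_same]
  refine ⟨v, fun j hj => hv j fun h => hj ?_, hVi, fun j hj => ?_, ?_⟩
  · exact Finset.insert_subset_insert i Finset.inter_subset_left h
  · by_cases hjc : j ∈ c
    · rw [hVv j (by simp [hT, hj, hjc]), Pi.single_eq_of_ne (ne_of_mem_of_not_mem hj hiK)]
    · exact hout j hjc
  have hsplit : ∑ j, |(V *ᵥ v) j| = ∑ j ∈ c \ T, |(V *ᵥ v) j| + 1 := by
    rw [← Finset.sum_subset (Finset.subset_univ c) (fun l _ hl => by simp [hout l hl]),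
      ← Finset.sum_sdiff hTc]
    congr 1
    rw [Finset.sum_congr rfl fun r hr => by rw [hVv r hr], Finset.sum_eq_single_of_mem i hiT]
    · simp
    · intro r _ hr
      simp [hr]
  rw [hsplit]
  rcases (c \ T).eq_empty_or_nonempty with he | hne
  · simpa [he] using one_le_gaussianFactor hρ0 hρm
  have hu : 1 ≤ (c \ T).card := hne.card_pos
  obtain ⟨k, hk⟩ : ∃ k, T.card = k + 1 := Nat.exists_eq_succ_of_ne_zero
    (Finset.card_ne_zero_of_mem hiT)
  have huk : k + (c \ T).card + 1 ≤ m := by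
    have := Finset.card_sdiff_add_card_eq_card hTc
    omega
  refine le_trans ?_ (mul_div_one_sub_mul_le_gaussianFactor hρ0 hρm hu huk)
  gcongr
  have hkρ : 0 < 1 - k * ρ := by
    have h1 : (k : ℝ) ≤ m - 2 := by
      have : (k : ℝ) + 1 + 1 ≤ m := by exact_mod_cast (by omega : k + 1 + 1 ≤ m)
      linarith
    linarith [mul_le_mul_of_nonneg_left h1 hρ0]
  have hS := sum_abs_mul_le_one hdiag hoff hiT hv hVv
  rw [hk, Nat.cast_add_one, add_sub_cancel_right] at hS
  rw [← nsmul_eq_mul]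
  refine Finset.sum_le_card_nsmul _ _ _ fun j hj => ?_
  have hjT : j ∉ T := (Finset.mem_sdiff.1 hj).2
  calc |(V *ᵥ v) j| ≤ ρ * (σ2 * ∑ r ∈ T, |v r|) := by
        have h1 : (V *ᵥ v) j = ∑ r ∈ T, V j r * v r :=
          (Finset.sum_subset (Finset.subset_univ T) fun r _ hr => by simp [hv r hr]).symm
        rw [h1, ← mul_assoc, Finset.mul_sum]
        refine (Finset.abs_sum_le_sum_abs _ _).trans (Finset.sum_le_sum fun r hr => ?_)
        rw [abs_mul]
        exact mul_le_mul_of_nonneg_right (hoff j r fun h => hjT (h ▸ hr)) (abs_nonneg _)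
    _ ≤ ρ / (1 - k * ρ) := by
        rw [div_eq_mul_one_div]
        refine mul_le_mul_of_nonneg_left ?_ hρ0
        rw [le_div_iff₀ hkρ]
        linarith

/-! ### Coupling two target values -/

theorem l1Dist_clip_le {n : ℕ} (a b : ℝ) (D D' : Fin n → ℝ) :
    l1Dist (clip a b D) (clip a b D') ≤ l1Dist D D' := by
  refine Finset.sum_le_sum fun i _ => ?_
  simp only [clip]
  exact (abs_max_sub_max_le_max _ _ _ _).trans
    (max_le (by simp) ((abs_min_sub_min_le_max _ _ _ _).trans (max_le (by simp) le_rfl)))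

/-- The translation `y ↦ y + (t' - t) d_U` of the unknown records, with `d = V *ᵥ v`, carries the
conditional law for the target value `t` to the one for `t'`. -/
theorem condProb_clipped_le {n : ℕ} {Y : Type*} [MeasurableSpace Y] {μ : Fin n → ℝ}
    {V : Matrix (Fin n) (Fin n) ℝ} (hV : V.PosDef) {ε : ℝ} (hε : 0 ≤ ε) {𝓜 : Mechanism n Y}
    (h𝓜 : IsMetricPrivate (fun D D' => ε * l1Dist D D') 𝓜) (a b : ℝ)
    {K : Finset (Fin n)} {i : Fin n} (hiK : i ∉ K) {v : Fin n → ℝ}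
    (hv : ∀ j ∉ insert i K, v j = 0) (hVi : (V *ᵥ v) i = 1) (hVK : ∀ j ∈ K, (V *ᵥ v) j = 0)
    (xK : {j // j ∈ K} → ℝ) (t t' : ℝ) {S : Set Y} (hS : MeasurableSet S) :
    condProb (𝓜.clipped a b) (gaussianDensity μ V) K i xK t S ≤
      ENNReal.ofReal (Real.exp (ε * (|t - t'| * ∑ j, |(V *ᵥ v) j|))) *
        condProb (𝓜.clipped a b) (gaussianDensity μ V) K i xK t' S := by
  set p := gaussianDensity μ V with hp
  set d : {j // j ∉ insert i K} → ℝ := fun j => (t' - t) * (V *ᵥ v) j with hd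
  have hshift : ∀ y, assemble K i xK t' (y + d) =
      assemble K i xK t y + V *ᵥ ((t' - t) • v) := by
    intro y
    ext j
    rw [mulVec_smul]
    by_cases hK : j ∈ K
    · simp [assemble, hK, hVK j hK]
    · by_cases hi : j = i
      · subst hi
        simp [assemble, hK, hVi]
      · simp [assemble, hK, hi, hd]
  obtain ⟨q, hq0, hqt, hq⟩ : ∃ q : ℝ≥0∞, q ≠ 0 ∧ q ≠ ⊤ ∧
      ∀ y, p (assemble K i xK t' (y + d)) = q * p (assemble K i xK t y) := by
    -- `v ⬝ᵥ assemble K i xK t y` does not depend on `y`, as `v` vanishes on the unknown records.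
    have hconst : ∀ y, v ⬝ᵥ assemble K i xK t y = v ⬝ᵥ assemble K i xK t 0 := by
      intro y
      refine Finset.sum_congr rfl fun j _ => ?_
      by_cases hj : j ∈ insert i K
      · congr 1
        rcases Finset.mem_insert.1 hj with h | h
        · subst h
          simp [assemble, hiK]
        · simp [assemble, h]
      · simp [hv j hj]
    refine ⟨ENNReal.ofReal (Real.exp (-(((t' - t) • v) ⬝ᵥ (assemble K i xK t 0 - μ)) -
      1 / 2 * (((t' - t) • v) ⬝ᵥ V *ᵥ ((t' - t) • v)))),
      (ENNReal.ofReal_pos.2 (Real.exp_pos _)).ne', ENNReal.ofReal_ne_top, fun y => ?_⟩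
    rw [hshift, hp, gaussianDensity_add_mulVec μ hV, dotProduct_sub, dotProduct_sub,
      smul_dotProduct _ v (assemble K i xK t y), hconst y,
      smul_dotProduct _ v (assemble K i xK t 0)]
  have hmech : ∀ y, 𝓜.clipped a b (assemble K i xK t y) S ≤
      ENNReal.ofReal (Real.exp (ε * (|t - t'| * ∑ j, |(V *ᵥ v) j|))) *
        𝓜.clipped a b (assemble K i xK t' (y + d)) S := by
    intro y
    refine (h𝓜 _ (clip a b (assemble K i xK t' (y + d))) S hS).trans ?_
    refine mul_le_mul_left (ENNReal.ofReal_le_ofReal (Real.exp_le_exp.2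
      (mul_le_mul_of_nonneg_left ?_ hε))) _
    refine (l1Dist_clip_le _ _ _ _).trans_eq ?_
    rw [hshift, l1Dist, Finset.mul_sum]
    refine Finset.sum_congr rfl fun j _ => ?_
    rw [mulVec_smul, Pi.add_apply, Pi.smul_apply, smul_eq_mul, sub_add_cancel_left, abs_neg,
      abs_mul, abs_sub_comm]
  have hden : ∫⁻ z, p (assemble K i xK t' z) = q * ∫⁻ z, p (assemble K i xK t z) := by
    rw [← lintegral_add_right_eq_self (fun z => p (assemble K i xK t' z)) d,
      lintegral_congr hq, lintegral_const_mul' _ _ hqt]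
  unfold condProb
  rw [← lintegral_const_mul' _ _ ENNReal.ofReal_ne_top, hden,
    ← lintegral_add_right_eq_self (fun y => ENNReal.ofReal _ * (_ * (_ / _))) d]
  refine lintegral_mono fun y => ?_
  simp only [hq, ENNReal.mul_div_mul_left _ _ hq0 hqt]
  rw [← mul_assoc]
  gcongr
  exact hmech y

end BayesDP

theorem mainTheorem2 {n m : ℕ} (hmn : m ≤ n) {Y : Type*} [MeasurableSpace Y]
    {Ω : Type*} [MeasurableSpace Ω] (P : Measure Ω) [IsProbabilityMeasure P]
    (X : Ω → Fin n → ℝ) (μ : Fin n → ℝ) (V : Matrix (Fin n) (Fin n) ℝ)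
    (ρ : ℝ) (hρ0 : 0 ≤ ρ) (hρ1 : ρ ≤ 1) (hρm : ρ * ((m : ℝ) - 2) < 1)
    (hV : BayesDP.IsLimitedCovariance ρ V)
    (hX : BayesDP.HasDensity P X (BayesDP.gaussianDensity μ V))
    (hcorr : BayesDP.AtMostCorrelated P X m)
    (ε : ℝ) (hε : 0 < ε) (𝓜 : BayesDP.Mechanism n Y) [IsMarkovKernel 𝓜]
    (h𝓜 : BayesDP.IsMetricPrivate (fun D D' => ε * BayesDP.l1Dist D D') 𝓜)
    (a b : ℝ) (hab : a ≤ b) :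
    BayesDP.IsBDP (𝓜.clipped a b) (BayesDP.gaussianDensity μ V) (b - a)
      (BayesDP.gaussianFactor m ρ * (b - a) * ε) := by
  obtain ⟨C, hC⟩ := hcorr
  refine iSup_le fun i => iSup_le fun K => iSup_le fun hiK => iSup_le fun xK => iSup_le fun t =>
    iSup_le fun t' => iSup_le fun htt => iSup_le fun S => iSup_le fun hS => ?_
  obtain ⟨c, hc, hic⟩ := C.exists_mem (Finset.mem_univ i)
  have hblock : ∀ j ∈ c, ∀ l ∉ c, V l j = 0 := by
    intro j hj l hl
    have hφ : Measurable fun x : {j // j ∈ c} → ℝ => x ⟨j, hj⟩ := measurable_pi_apply _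
    have hψ : Measurable fun x : {j // j ∉ c} → ℝ => x ⟨l, hl⟩ := measurable_pi_apply _
    exact BayesDP.covariance_apply_eq_zero_of_indepFun hV.1 hX ((hC c hc).2.comp hφ hψ).symm
  obtain ⟨v, hv, hVi, hVK, hsum⟩ :=
    BayesDP.exists_conditionalMean_direction hρ0 hρm hV (hC c hc).1 hblock hic hiK
  have h := BayesDP.condProb_clipped_le (μ := μ) hV.1 hε.le h𝓜 a b hiK hv hVi hVK xK t t' hS
  refine (ENNReal.log_le_log (ENNReal.div_le_of_le_mul h)).trans ?_
  rw [ENNReal.log_ofReal_of_pos (Real.exp_pos _), Real.log_exp, EReal.coe_le_coe_iff]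
  have hprod := mul_le_mul htt hsum (Finset.sum_nonneg fun j _ => abs_nonneg _)
    (sub_nonneg.2 hab)
  linarith [mul_le_mul_of_nonneg_left hprod hε.le]
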